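/- **Model.** A server transmits packets to $N$ users in slots $t=0,1,2,\dots$. The number $A_n(t)\in\{0,\dots,A_{\max}\}$ of packets arriving for user $n$ at time $t$ is i.i.d. over time and independent across users, with mean $a_n$. A packet arriving at time $t$ for user $n$ must be delivered by time $t+\tau_n$, otherwise it is discarded. Prediction is perfect: at time $t$ all arrivals up to time $t+D_n$ are known exactly, and these future packets may already be served; thus a packet of user $n$ becomes known when its time to deadline is $\tau_n+D_n$, and it has $\tau_n+D_n$ slots in which it can be transmitted. The setting is static: in each slot each known packet that is still at the source is either transmitted, at the cost of one unit of resource, or not; a transmission takes one slot and succeeds with constant probability $\zeta_n\in(0,1]$, independently of everything else. The number of simultaneous transmissions is not limited. A (possibly randomized) policy $\pi$ decides, as a function of the system state (the user, the reception status and the time to deadline of every known packet), which packets to transmit. The initial state has an arbitrary fixed law. Let $X_n(t)$ and $E_n(t)$ be the number of packets of user $n$ delivered, respectively the resource spent on user $n$, in slot $t$. Put $x_n=\lim_{T\to\infty}\frac1T\mathbb E\sum_{t=1}^T X_n(t)$ and $E_{av}=\lim_{T\to\infty}\frac1T\mathbb E\sum_{t=1}^T\sum_{n=1}^N E_n(t)$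 (policies are considered for which the limits in question exist). For weights $\beta_n\ge 0$ and a budget $B\ge 0$ let $$\phi_P^*=\max_\pi\Big\{\sum_{n=1}^N\beta_nx_n \;:\; E_{av}\le B\Big\},$$ $$L(\pi,\lambda)=\lim_{T\to\infty}\frac1T\Big[\mathbb E\sum_{n=1}^N\sum_{t=1}^T\beta_nX_n(t)-\lambda\,\mathbb E\sum_{t=1}^T\sum_{n=1}^NE_n(t)\Big]+\lambda B,\qquad g_P(\lambda)=\max_\pi L(\pi,\lambda).$$ **Statement.** For every $\lambda\in\mathbb R$ the maximum defining the dual function $g_P(\lambda)$ is attained, and $$g_P(\lambda)=\sum_{n:\ \zeta_n\beta_n>\lambda}a_n\,\frac{1-(1-\zeta_n)^{\tau_n+D_n}}{\zeta_n}\,(\zeta_n\beta_n-\lambda)+\lambda B .$$ The maximum defining the optimal weighted timely-throughput $\phi_P^*$ is attained, and $$\phi_P^*=\min_{\lambda\ge0}g_P(\lambda),$$ where the minimum is attained as well. -/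

import Mathlib

open Filter Topology

noncomputable section

/-- The joint law of independent random variables, the `i`-th of which has law `p i`. -/
def indepLaw {ι : Type} [Fintype ι] [DecidableEq ι] {α : ι → Type} [∀ i, Fintype (α i)]
    (p : ∀ i, PMF (α i)) : PMF (∀ i, α i) :=
  PMF.ofFintype (fun x => ∏ i, p i (x i)) (by
    rw [← Fintype.prod_sum (fun i a => p i a)]
    refine Finset.prod_eq_one fun i _ => ?_
    have h := (p i).tsum_coe
    rwa [tsum_fintype] at h)

/-- The law of a coin that shows `true` with probability `p`. -/
def coinLaw (p : ℝ) (h₀ : 0 ≤ p) (h₁ : p ≤ 1) : PMF Bool :=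
  PMF.ofFintype (fun b => if b = true then ENNReal.ofReal p else ENNReal.ofReal (1 - p)) (by
    rw [Fintype.sum_bool]
    simp only [if_true, Bool.false_eq_true, if_false]
    rw [← ENNReal.ofReal_add h₀ (by linarith)]
    simp)

/-- The expectation of `f` under a law on a finite type. -/
def expect {α : Type} [Fintype α] (p : PMF α) (f : α → ℝ) : ℝ :=
  ∑ a, (p a).toReal * f a

/-- The static downlink scheduling system with perfect prediction: one server, `N` users, unreliable
channels with constant success probabilities, and resource levels `{0, 1}`. -/
structure StaticSystem where
  /-- number of users -/
  N : ℕ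
  /-- largest possible number of arrivals for a user in a slot -/
  Amax : ℕ
  /-- law of the number `A_n(t)` of packets arriving for user `n` in a slot -/
  arrival : Fin N → PMF (Fin (Amax + 1))
  /-- deadlines: a packet arriving at `t` has to be delivered by `t + τ n` -/
  τ : Fin N → ℕ
  /-- prediction windows: at time `t` the arrivals up to time `t + D n` are known -/
  D : Fin N → ℕ
  /-- success probability of a single transmission -/
  ζ : Fin N → ℝ
  ζ_pos : ∀ n, 0 < ζ n
  ζ_le_one : ∀ n, ζ n ≤ 1
  /-- weights -/
  β : Fin N → ℝ
  β_nonneg : ∀ n, 0 ≤ β n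
  /-- bound on the average resource expenditure -/
  B : ℝ
  B_nonneg : 0 ≤ B

namespace StaticSystem

/-- The arrival rate `a_n = E[A_n(t)]`. -/
def a (M : StaticSystem) (n : Fin M.N) : ℝ :=
  expect (M.arrival n) fun k => ((k : ℕ) : ℝ)

/-- The places that packets known to the server can occupy. The place `⟨n, j, k⟩` is for the
`k`-th packet of user `n` among those whose time to deadline is `j + 1`. With perfect prediction
a packet becomes known, and can be served, when its time to deadline is `τ n + D n`. -/
abbrev Place (M : StaticSystem) : Type :=
  Σ n : Fin M.N, Fin (M.τ n + M.D n) × Fin M.Amax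

/-- The state of the system is the state of all packets: `none` means that there is no packet at
this place, `some false` that the packet is still at the source (`r = 0`), and `some true` that it
has reached its destination (`r = 1`). -/
abbrev State (M : StaticSystem) : Type := M.Place → Option Bool

/-- A randomized scheduling policy: in each system state it chooses, by a law on sets of packets,
which of the packets that are still at the source are transmitted. -/
structure Policy (M : StaticSystem) where
  decide : M.State → PMF (Finset M.Place)
  admissible : ∀ s, ∀ u ∈ (decide s).support, ∀ ξ ∈ u, s ξ = some false

/-- What is drawn in a slot: the set of transmitted packets, the quality of the channel for each
packet (`true` if a transmission succeeds), and the numbers of packets that become known next. -/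
abbrev Draw (M : StaticSystem) : Type :=
  Finset M.Place × (M.Place → Bool) × (Fin M.N → Fin (M.Amax + 1))

/-- The law of what is drawn in a slot that starts in state `s`: given the decision, transmissions
succeed independently with probability `ζ n`, and arrivals are independent of everything else
and of each other. -/
def drawLaw (M : StaticSystem) (π : M.Policy) (s : M.State) : PMF M.Draw :=
  (π.decide s).bind fun u =>
    (indepLaw fun ξ : M.Place => coinLaw (M.ζ ξ.1) (M.ζ_pos ξ.1).le (M.ζ_le_one ξ.1)).bind fun c =>
      (indepLaw M.arrival).map fun A => (u, c, A)

/-- The packets delivered in a slot. -/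
def delivered (M : StaticSystem) (w : M.Draw) : Finset M.Place :=
  w.1.filter fun ξ => w.2.1 ξ = true

/-- The next state: the reception status of delivered packets becomes `some true`, all times to
deadline go down by one, packets whose time to deadline becomes `0` leave the system, and for each
user `n` the next predicted arrivals enter with time to deadline `τ n + D n`. -/
def next (M : StaticSystem) (s : M.State) (w : M.Draw) : M.State := fun ξ =>
  if h : (ξ.2.1 : ℕ) + 1 < M.τ ξ.1 + M.D ξ.1 then
    let ξ' : M.Place := ⟨ξ.1, ⟨(ξ.2.1 : ℕ) + 1, h⟩, ξ.2.2⟩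
    if ξ' ∈ M.delivered w then some true else s ξ'
  else
    if (ξ.2.2 : ℕ) < (w.2.2 ξ.1 : ℕ) then some false else none

/-- The law of the system state at time `t` under the policy `π`, for the initial law `ν`. -/
def stateLaw (M : StaticSystem) (ν : PMF M.State) (π : M.Policy) : ℕ → PMF M.State
  | 0 => ν
  | t + 1 => (M.stateLaw ν π t).bind fun s => (M.drawLaw π s).map (M.next s)

/-- `E[X_n(t)]`, the expected number of packets of user `n` that are delivered in slot `t`. -/
def expDelivered (M : StaticSystem) (ν : PMF M.State) (π : M.Policy) (n : Fin M.N) (t : ℕ) : ℝ :=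
  expect (M.stateLaw ν π t) fun s => expect (M.drawLaw π s) fun w =>
    (((M.delivered w).filter fun ξ => ξ.1 = n).card : ℝ)

/-- `E[E_n(t)]`, the expected resource consumption for user `n` in slot `t`: one unit for each
transmitted packet. -/
def expResource (M : StaticSystem) (ν : PMF M.State) (π : M.Policy) (n : Fin M.N) (t : ℕ) : ℝ :=
  expect (M.stateLaw ν π t) fun s => expect (M.drawLaw π s) fun w =>
    ((w.1.filter fun ξ => ξ.1 = n).card : ℝ)

/-- `x n` is the timely-throughput of user `n` under `π`, for all `n`. -/
def IsThroughput (M : StaticSystem) (ν : PMF M.State) (π : M.Policy) (x : Fin M.N → ℝ) : Prop :=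
  ∀ n, Tendsto (fun T : ℕ => (1 / (T : ℝ)) * ∑ t ∈ Finset.Icc 1 T, M.expDelivered ν π n t)
    atTop (𝓝 (x n))

/-- `e` is the average resource expenditure under `π`. -/
def IsExpenditure (M : StaticSystem) (ν : PMF M.State) (π : M.Policy) (e : ℝ) : Prop :=
  Tendsto (fun T : ℕ => (1 / (T : ℝ)) * ∑ t ∈ Finset.Icc 1 T, ∑ n, M.expResource ν π n t)
    atTop (𝓝 e)

/-- The weighted timely-throughputs of the policies that respect the resource constraint. -/
def feasibleValues (M : StaticSystem) (ν : PMF M.State) : Set ℝ :=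
  {φ | ∃ (π : M.Policy) (x : Fin M.N → ℝ) (e : ℝ),
    M.IsThroughput ν π x ∧ M.IsExpenditure ν π e ∧ e ≤ M.B ∧ φ = ∑ n, M.β n * x n}

/-- `L` is the value `L(π, l)` of the Lagrangian. -/
def IsLagrangian (M : StaticSystem) (ν : PMF M.State) (π : M.Policy) (l L : ℝ) : Prop :=
  ∃ v : ℝ,
    Tendsto (fun T : ℕ => (1 / (T : ℝ)) *
      ((∑ n, ∑ t ∈ Finset.Icc 1 T, M.β n * M.expDelivered ν π n t)
        - l * ∑ t ∈ Finset.Icc 1 T, ∑ n, M.expResource ν π n t)) atTop (𝓝 v) ∧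
    L = v + l * M.B

/-- The values `L(π, l)` of the Lagrangian over all policies `π`. -/
def lagrangianValues (M : StaticSystem) (ν : PMF M.State) (l : ℝ) : Set ℝ :=
  {L | ∃ π : M.Policy, M.IsLagrangian ν π l L}

end StaticSystem

end

/-! Only marginals matter: by linearity, reward and cost depend on the policy only through the
probabilities that the packet at each place is alive (`meanAlive`) and is sent (`meanSend`). Success
is independent of the decision, so deliveries are `ζ n` times expenditure (`expDelivered_eq`) and
the Lagrangian charges `ζ n * β n - l` per transmission. Weighting alive packets by `W n j`, with `W
n 0 = 0`, gives a bounded potential whose increments telescope. Hence a linear functional of these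
marginals has a Cesàro limit independent of policy and initial law (`tendsto_cesaro_potential`).
Taking for `W` the optimal value of one packet bounds the Lagrangian above
(`lagrangian_le_dualValue`); taking the expected number of transmissions of one packet evaluates
policies with constant sending probabilities (`tendsto_expResource`). Threshold policies attain the
bound. Weak duality and a threshold policy with complementary slackness
(`exists_complementary_slackness`) give strong duality. -/

noncomputable section

/-! ### Expectations on finite types -/

section Expect

variable {α β : Type} [Fintype α] [Fintype β]

lemma expect_sub (p : PMF α) (f g : α → ℝ) :
    expect p (fun a => f a - g a) = expect p f - expect p g := by
  simp [expect, mul_sub, Finset.sum_sub_distrib]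

lemma expect_const_mul (p : PMF α) (c : ℝ) (f : α → ℝ) :
    expect p (fun a => c * f a) = c * expect p f := by
  simp only [expect, Finset.mul_sum]
  exact Finset.sum_congr rfl fun a _ => by ring

lemma expect_sum {ι : Type} (s : Finset ι) (p : PMF α) (f : ι → α → ℝ) :
    expect p (fun a => ∑ i ∈ s, f i a) = ∑ i ∈ s, expect p (f i) := by
  simp only [expect, Finset.mul_sum]
  exact Finset.sum_comm

lemma sum_toReal_eq_one (p : PMF α) : ∑ a, (p a).toReal = 1 := by
  rw [← ENNReal.toReal_sum fun a _ => p.apply_ne_top a, ← tsum_fintype (L := .unconditional α),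
    p.tsum_coe, ENNReal.toReal_one]

lemma expect_const (p : PMF α) (c : ℝ) : expect p (fun _ => c) = c := by
  rw [expect, ← Finset.sum_mul, sum_toReal_eq_one, one_mul]

lemma expect_mono_support {p : PMF α} {f g : α → ℝ} (h : ∀ a ∈ p.support, f a ≤ g a) :
    expect p f ≤ expect p g := by
  refine Finset.sum_le_sum fun a _ => ?_
  by_cases ha : a ∈ p.support
  · exact mul_le_mul_of_nonneg_left (h a ha) ENNReal.toReal_nonneg
  · rw [PMF.mem_support_iff, not_not] at ha
    simp [ha]

lemma expect_congr_support {p : PMF α} {f g : α → ℝ} (h : ∀ a ∈ p.support, f a = g a) :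
    expect p f = expect p g :=
  le_antisymm (expect_mono_support fun a ha => (h a ha).le)
    (expect_mono_support fun a ha => (h a ha).ge)

lemma expect_nonneg (p : PMF α) {f : α → ℝ} (h : ∀ a, 0 ≤ f a) : 0 ≤ expect p f :=
  Finset.sum_nonneg fun a _ => mul_nonneg ENNReal.toReal_nonneg (h a)

lemma expect_bind (p : PMF α) (k : α → PMF β) (f : β → ℝ) :
    expect (p.bind k) f = expect p fun a => expect (k a) f := by
  simp only [expect, PMF.bind_apply, tsum_fintype, Finset.mul_sum]
  rw [Finset.sum_comm]
  refine Finset.sum_congr rfl fun b _ => ?_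
  rw [ENNReal.toReal_sum fun a _ =>
    ENNReal.mul_ne_top (p.apply_ne_top a) ((k a).apply_ne_top b), Finset.sum_mul]
  exact Finset.sum_congr rfl fun a _ => by rw [ENNReal.toReal_mul, mul_assoc]

lemma expect_pure (a : α) (f : α → ℝ) : expect (PMF.pure a) f = f a := by
  classical
  rw [expect, Finset.sum_eq_single a]
  · simp
  · intro b _ hb
    simp [PMF.pure_apply, hb]
  · simp

lemma expect_map (p : PMF α) (k : α → β) (f : β → ℝ) :
    expect (p.map k) f = expect p fun a => f (k a) := by
  rw [← PMF.bind_pure_comp, expect_bind]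
  simp [expect_pure]

lemma expect_coinLaw (p : ℝ) (h₀ : 0 ≤ p) (h₁ : p ≤ 1) (f : Bool → ℝ) :
    expect (coinLaw p h₀ h₁) f = p * f true + (1 - p) * f false := by
  simp [expect, coinLaw, ENNReal.toReal_ofReal, h₀, h₁]

lemma expect_indepLaw_eval {ι : Type} [Fintype ι] [DecidableEq ι] {α : ι → Type}
    [∀ i, Fintype (α i)] (p : ∀ i, PMF (α i)) (i : ι) (f : α i → ℝ) :
    expect (indepLaw p) (fun x => f (x i)) = expect (p i) f := by
  -- Padding with ones makes the integrand a product over coordinates, so the sum over all tuples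
  -- factorizes.
  let g : ∀ j, α j → ℝ := fun j a => if h : j = i then f (h ▸ a) else 1
  have hg : ∀ x : ∀ j, α j, ∏ j, g j (x j) = f (x i) := fun x => by
    rw [Finset.prod_eq_single i]
    · simp [g]
    · intro j _ hj
      simp [g, hj]
    · simp
  calc expect (indepLaw p) (fun x => f (x i))
      = ∑ x : ∀ j, α j, ∏ j, ((p j (x j)).toReal * g j (x j)) := by
        refine Finset.sum_congr rfl fun x _ => ?_
        rw [Finset.prod_mul_distrib, hg]
        simp [indepLaw, ENNReal.toReal_prod]
    _ = ∏ j, ∑ a, (p j a).toReal * g j a :=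
        (Fintype.prod_sum fun j a => (p j a).toReal * g j a).symm
    _ = expect (p i) f := by
        rw [Finset.prod_eq_single i]
        · simp [g, expect]
        · intro j _ hj
          simp [g, hj, sum_toReal_eq_one]
        · simp

end Expect

/-! ### Telescoping averages and shifted sums -/

lemma tendsto_cesaro_sub_succ_add_const {u : ℕ → ℝ} {K : ℝ} (hu : ∀ t, |u t| ≤ K) (C : ℝ) :
    Tendsto (fun T : ℕ => (1 / (T : ℝ)) * ∑ t ∈ Finset.Icc 1 T, (u t - u (t + 1) + C))
      atTop (𝓝 C) := by
  have hsum : ∀ T : ℕ, ∑ t ∈ Finset.Icc 1 T, (u t - u (t + 1) + C) = u 1 - u (T + 1) + T * C := by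
    intro T
    induction T with
    | zero => simp
    | succ T ih =>
      rw [Finset.sum_Icc_succ_top (by omega), ih]
      push_cast
      ring
  have h0 : Tendsto (fun T : ℕ => (1 / (T : ℝ)) * (u 1 - u (T + 1))) atTop (𝓝 0) := by
    refine squeeze_zero_norm (a := fun T : ℕ => (1 / (T : ℝ)) * (K + K)) (fun T => ?_) ?_
    · rw [norm_mul, Real.norm_of_nonneg (by positivity)]
      gcongr
      exact (norm_sub_le _ _).trans (add_le_add (hu _) (hu _))
    · simpa using tendsto_one_div_atTop_nhds_zero_nat.mul_const (K + K)
  have h1 : Tendsto (fun T : ℕ => (1 / (T : ℝ)) * (u 1 - u (T + 1)) + C) atTop (𝓝 C) := by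
    simpa using h0.add_const C
  refine h1.congr' ?_
  -- At `T = 0` the average is `0`, not `C`, so the two sequences agree only for positive `T`.
  filter_upwards [eventually_gt_atTop 0] with T hT
  have : (T : ℝ) ≠ 0 := by positivity
  rw [hsum]
  field_simp

/-- Summation form of the ageing of packets: `f` moves down one place and `r` enters at the top. The
entry `f 0` expires, which costs nothing because `W 0 = 0`. -/
lemma sum_shift_eq {R : Type*} [CommRing R] {K : ℕ} (W : ℕ → R) (hW : W 0 = 0) (f : Fin K → R)
    (r : R) :
    ∑ j : Fin K, W (j + 1) * (if h : (j : ℕ) + 1 < K then f ⟨j + 1, h⟩ else r)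
      = ∑ j : Fin K, W j * f j + W K * r := by
  cases K with
  | zero => simp [hW]
  | succ m =>
    rw [Fin.sum_univ_castSucc, Fin.sum_univ_succ]
    simp [hW, Fin.succ]

/-! ### Marginal dynamics of one slot -/

namespace StaticSystem

variable (M : StaticSystem) (ν : PMF M.State) (π : M.Policy)

/-- The indicator that the packet at `ξ` is still at the source. -/
def alive (s : M.State) (ξ : M.Place) : ℝ := if s ξ = some false then 1 else 0

/-- The conditional probability that `ξ` is transmitted in state `s`. -/
def sendProb (s : M.State) (ξ : M.Place) : ℝ :=
  expect (π.decide s) fun u => if ξ ∈ u then 1 else 0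

/-- The probability that at time `t` there is a packet at `ξ` which is still at the source. -/
def meanAlive (t : ℕ) (ξ : M.Place) : ℝ := expect (M.stateLaw ν π t) fun s => M.alive s ξ

/-- The probability that the packet at `ξ` is transmitted in slot `t`. -/
def meanSend (t : ℕ) (ξ : M.Place) : ℝ := expect (M.stateLaw ν π t) fun s => M.sendProb π s ξ

/-- The probability that more than `k` packets arrive for user `n` in a slot. -/
def arrivalTail (n : Fin M.N) (k : ℕ) : ℝ :=
  expect (M.arrival n) fun A => if k < (A : ℕ) then 1 else 0

lemma sum_arrivalTail (n : Fin M.N) : ∑ k : Fin M.Amax, M.arrivalTail n k = M.a n := by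
  unfold arrivalTail
  rw [← expect_sum, a]
  congr 1
  funext A
  rw [Fin.sum_univ_eq_sum_range (fun k => if k < (A : ℕ) then (1 : ℝ) else 0), Finset.sum_boole,
    Finset.filter_congr (q := (· ∈ Finset.range A)) (by simp), Finset.filter_mem_eq_inter,
    Finset.inter_eq_right.2 (Finset.range_mono (Nat.le_of_lt_succ A.2)), Finset.card_range]

lemma alive_nonneg (s : M.State) (ξ : M.Place) : 0 ≤ M.alive s ξ := by
  unfold alive; split_ifs <;> norm_num

lemma alive_le_one (s : M.State) (ξ : M.Place) : M.alive s ξ ≤ 1 := by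
  unfold alive; split_ifs <;> norm_num

lemma meanAlive_nonneg (t : ℕ) (ξ : M.Place) : 0 ≤ M.meanAlive ν π t ξ :=
  expect_nonneg _ fun s => M.alive_nonneg s ξ

lemma meanAlive_le_one (t : ℕ) (ξ : M.Place) : M.meanAlive ν π t ξ ≤ 1 :=
  (expect_mono_support fun s _ => M.alive_le_one s ξ).trans_eq (expect_const _ 1)

lemma meanSend_nonneg (t : ℕ) (ξ : M.Place) : 0 ≤ M.meanSend ν π t ξ :=
  expect_nonneg _ fun s => expect_nonneg _ fun u => by split_ifs <;> norm_num

/-- The only constraint on decisions that the upper bound uses. -/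
lemma sendProb_le_alive (s : M.State) (ξ : M.Place) : M.sendProb π s ξ ≤ M.alive s ξ := by
  refine (expect_mono_support fun u hu => ?_).trans_eq (expect_const (π.decide s) (M.alive s ξ))
  split_ifs with h
  · simp [alive, π.admissible s u hu ξ h]
  · exact M.alive_nonneg s ξ

lemma meanSend_le_meanAlive (t : ℕ) (ξ : M.Place) : M.meanSend ν π t ξ ≤ M.meanAlive ν π t ξ :=
  expect_mono_support fun s _ => M.sendProb_le_alive π s ξ

/-- The law of the channel qualities in a slot. -/
def channelLaw : PMF (M.Place → Bool) :=
  indepLaw fun ξ : M.Place => coinLaw (M.ζ ξ.1) (M.ζ_pos ξ.1).le (M.ζ_le_one ξ.1)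

/-- The joint law of the numbers of arrivals in a slot. -/
def arrivalLaw : PMF (Fin M.N → Fin (M.Amax + 1)) := indepLaw M.arrival

lemma expect_channelLaw_eval (ξ : M.Place) (f : Bool → ℝ) :
    expect M.channelLaw (fun c => f (c ξ)) = M.ζ ξ.1 * f true + (1 - M.ζ ξ.1) * f false :=
  (expect_indepLaw_eval (α := fun _ => Bool) _ ξ f).trans (expect_coinLaw _ _ _ f)

lemma expect_arrivalLaw_eval (n : Fin M.N) (f : Fin (M.Amax + 1) → ℝ) :
    expect M.arrivalLaw (fun A => f (A n)) = expect (M.arrival n) f :=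
  expect_indepLaw_eval (α := fun _ => Fin (M.Amax + 1)) _ n f

lemma drawLaw_eq (s : M.State) :
    M.drawLaw π s = (π.decide s).bind fun u => M.channelLaw.bind fun c =>
      M.arrivalLaw.map fun A => (u, c, A) := rfl

lemma expect_drawLaw (s : M.State) (f : M.Draw → ℝ) :
    expect (M.drawLaw π s) f = expect (π.decide s) fun u =>
      expect M.channelLaw fun c => expect M.arrivalLaw fun A => f (u, c, A) := by
  simp only [drawLaw_eq, expect_bind, expect_map]

lemma expect_drawLaw_decision (s : M.State) (f : Finset M.Place → ℝ) :
    expect (M.drawLaw π s) (fun w => f w.1) = expect (π.decide s) f := by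
  simp only [expect_drawLaw, expect_const]

lemma expect_drawLaw_arrival (s : M.State) (n : Fin M.N) (f : Fin (M.Amax + 1) → ℝ) :
    expect (M.drawLaw π s) (fun w => f (w.2.2 n)) = expect (M.arrival n) f := by
  simp only [expect_drawLaw, expect_arrivalLaw_eval, expect_const]

lemma expect_drawLaw_delivered (s : M.State) (ξ : M.Place) :
    expect (M.drawLaw π s) (fun w => if ξ ∈ M.delivered w then 1 else 0)
      = M.ζ ξ.1 * M.sendProb π s ξ := by
  have h : ∀ (u : Finset M.Place) (c : M.Place → Bool) (A : Fin M.N → Fin (M.Amax + 1)),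
      (if ξ ∈ M.delivered (u, c, A) then (1 : ℝ) else 0)
        = (if ξ ∈ u then 1 else 0) * (if c ξ = true then 1 else 0) := fun u c A => by
    by_cases h₁ : ξ ∈ u <;> by_cases h₂ : c ξ = true <;> simp [delivered, h₁, h₂]
  rw [expect_drawLaw, sendProb, ← expect_const_mul]
  congr 1
  funext u
  simp only [h, expect_const]
  rw [expect_const_mul,
    M.expect_channelLaw_eval ξ (fun b : Bool => if b = true then (1 : ℝ) else 0)]
  simp [mul_comm]

lemma alive_of_mem_delivered {s : M.State} {u : Finset M.Place} (hu : u ∈ (π.decide s).support)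
    {c : M.Place → Bool} {A : Fin M.N → Fin (M.Amax + 1)} {ξ : M.Place}
    (hξ : ξ ∈ M.delivered (u, c, A)) : s ξ = some false :=
  π.admissible s u hu ξ (Finset.mem_filter.1 hξ).1

/-- Admissibility makes every delivered packet one that was alive, so on the support of the decision
the new indicator is exactly the old one minus that of delivery. -/
lemma expect_drawLaw_alive_next (s : M.State) (ξ : M.Place) :
    expect (M.drawLaw π s) (fun w => M.alive (M.next s w) ξ)
      = if h : (ξ.2.1 : ℕ) + 1 < M.τ ξ.1 + M.D ξ.1 then
          M.alive s ⟨ξ.1, ⟨(ξ.2.1 : ℕ) + 1, h⟩, ξ.2.2⟩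
            - M.ζ ξ.1 * M.sendProb π s ⟨ξ.1, ⟨(ξ.2.1 : ℕ) + 1, h⟩, ξ.2.2⟩
        else M.arrivalTail ξ.1 ξ.2.2 := by
  split_ifs with h
  · set ξ' : M.Place := ⟨ξ.1, ⟨(ξ.2.1 : ℕ) + 1, h⟩, ξ.2.2⟩ with hξ'
    have hd := M.expect_drawLaw_delivered π s ξ'
    rw [show M.ζ ξ.1 = M.ζ ξ'.1 from rfl, ← hd, ← expect_const (M.drawLaw π s) (M.alive s ξ'),
      ← expect_sub, expect_drawLaw, expect_drawLaw]
    refine expect_congr_support fun u hu => ?_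
    congr 1
    funext c
    congr 1
    funext A
    by_cases hm : ξ' ∈ M.delivered (u, c, A)
    · have := M.alive_of_mem_delivered π hu hm
      simp [alive, next, h, ← hξ', hm, this]
    · simp [alive, next, h, ← hξ', hm]
  · rw [arrivalTail, ← M.expect_drawLaw_arrival π s]
    congr 1
    funext w
    by_cases hk : (ξ.2.2 : ℕ) < (w.2.2 ξ.1 : ℕ) <;> simp [alive, next, h, hk]

lemma meanAlive_succ (t : ℕ) (ξ : M.Place) :
    M.meanAlive ν π (t + 1) ξ
      = if h : (ξ.2.1 : ℕ) + 1 < M.τ ξ.1 + M.D ξ.1 then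
          M.meanAlive ν π t ⟨ξ.1, ⟨(ξ.2.1 : ℕ) + 1, h⟩, ξ.2.2⟩
            - M.ζ ξ.1 * M.meanSend ν π t ⟨ξ.1, ⟨(ξ.2.1 : ℕ) + 1, h⟩, ξ.2.2⟩
        else M.arrivalTail ξ.1 ξ.2.2 := by
  simp only [meanAlive, stateLaw, expect_bind, expect_map, expect_drawLaw_alive_next]
  split_ifs with h
  · rw [expect_sub, expect_const_mul]
    rfl
  · exact expect_const _ _

lemma card_filter_user (u : Finset M.Place) (n : Fin M.N) :
    ((u.filter fun ξ => ξ.1 = n).card : ℝ)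
      = ∑ ξ ∈ Finset.univ.filter (fun ξ : M.Place => ξ.1 = n), if ξ ∈ u then 1 else 0 := by
  rw [Finset.sum_boole, Finset.filter_filter]
  congr 2
  ext ξ
  simp [and_comm]

lemma expResource_eq (n : Fin M.N) (t : ℕ) :
    M.expResource ν π n t
      = ∑ ξ ∈ Finset.univ.filter (fun ξ : M.Place => ξ.1 = n), M.meanSend ν π t ξ := by
  simp only [expResource, card_filter_user, expect_sum, meanSend, sendProb]
  refine Finset.sum_congr rfl fun ξ _ => ?_
  congr 1
  funext s
  exact M.expect_drawLaw_decision π s fun u => if ξ ∈ u then 1 else 0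

lemma expDelivered_eq (n : Fin M.N) (t : ℕ) :
    M.expDelivered ν π n t = M.ζ n * M.expResource ν π n t := by
  rw [expResource_eq, Finset.mul_sum]
  simp only [expDelivered, card_filter_user, expect_sum, expect_drawLaw_delivered,
    expect_const_mul]
  refine Finset.sum_congr rfl fun ξ hξ => ?_
  rw [(Finset.mem_filter.1 hξ).2]
  rfl

/-! ### The potential and its drift -/

/-- The potential of the packets that are at the source at time `t`, where a packet of user `n`
with time to deadline `j` counts `W n j`. -/
def potential (W : Fin M.N → ℕ → ℝ) (t : ℕ) : ℝ :=
  ∑ ξ : M.Place, W ξ.1 (ξ.2.1 + 1) * M.meanAlive ν π t ξ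

lemma abs_potential_le (W : Fin M.N → ℕ → ℝ) (t : ℕ) :
    |M.potential ν π W t| ≤ ∑ ξ : M.Place, |W ξ.1 (ξ.2.1 + 1)| := by
  refine (Finset.abs_sum_le_sum_abs _ _).trans (Finset.sum_le_sum fun ξ _ => ?_)
  rw [abs_mul, abs_of_nonneg (M.meanAlive_nonneg ν π t ξ)]
  exact mul_le_of_le_one_right (abs_nonneg _) (M.meanAlive_le_one ν π t ξ)

lemma potential_succ (W : Fin M.N → ℕ → ℝ) (hW : ∀ n, W n 0 = 0) (t : ℕ) :
    M.potential ν π W (t + 1)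
      = ∑ ξ : M.Place, W ξ.1 ξ.2.1 * (M.meanAlive ν π t ξ - M.ζ ξ.1 * M.meanSend ν π t ξ)
        + ∑ n, M.a n * W n (M.τ n + M.D n) := by
  unfold potential
  simp only [Fintype.sum_sigma, Fintype.sum_prod_type_right, meanAlive_succ,
    ← Finset.sum_add_distrib]
  refine Finset.sum_congr rfl fun n _ => ?_
  rw [mul_comm (M.a n), ← sum_arrivalTail, Finset.mul_sum, ← Finset.sum_add_distrib]
  refine Finset.sum_congr rfl fun k _ => ?_
  exact sum_shift_eq (W n) (hW n) (fun j => M.meanAlive ν π t ⟨n, j, k⟩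
    - M.ζ n * M.meanSend ν π t ⟨n, j, k⟩) (M.arrivalTail n k)

lemma tendsto_cesaro_potential (W : Fin M.N → ℕ → ℝ) (hW : ∀ n, W n 0 = 0) :
    Tendsto (fun T : ℕ => (1 / (T : ℝ)) * ∑ t ∈ Finset.Icc 1 T, ∑ ξ : M.Place,
        ((W ξ.1 (ξ.2.1 + 1) - W ξ.1 ξ.2.1) * M.meanAlive ν π t ξ
          + M.ζ ξ.1 * W ξ.1 ξ.2.1 * M.meanSend ν π t ξ))
      atTop (𝓝 (∑ n, M.a n * W n (M.τ n + M.D n))) := by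
  refine (tendsto_cesaro_sub_succ_add_const (M.abs_potential_le ν π W)
    (∑ n, M.a n * W n (M.τ n + M.D n))).congr fun T => ?_
  congr 1
  refine Finset.sum_congr rfl fun t _ => ?_
  rw [M.potential_succ ν π W hW, potential, sub_add_eq_sub_sub, sub_add_cancel,
    ← Finset.sum_sub_distrib]
  exact Finset.sum_congr rfl fun ξ _ => by ring

lemma sum_user_eq (c : Fin M.N → ℝ) (f : M.Place → ℝ) :
    ∑ n, c n * ∑ ξ ∈ Finset.univ.filter (fun ξ : M.Place => ξ.1 = n), f ξ
      = ∑ ξ : M.Place, c ξ.1 * f ξ := by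
  rw [← Finset.sum_fiberwise (g := fun ξ : M.Place => ξ.1)]
  refine Finset.sum_congr rfl fun n _ => ?_
  rw [Finset.mul_sum]
  exact Finset.sum_congr rfl fun ξ hξ => by rw [(Finset.mem_filter.1 hξ).2]

/-! ### Upper bound and stationary policies -/

/-- The expected number of transmissions per packet of user `n`, if in each slot it is
transmitted with probability `θ` until it is delivered. -/
def load (n : Fin M.N) (θ : ℝ) : ℝ := (1 - (1 - θ * M.ζ n) ^ (M.τ n + M.D n)) / M.ζ n

/-- The dual function. -/
def dualValue (l : ℝ) : ℝ :=
  (∑ n ∈ Finset.univ.filter (fun n : Fin M.N => l < M.ζ n * M.β n),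
    M.a n * ((1 - (1 - M.ζ n) ^ (M.τ n + M.D n)) / M.ζ n) * (-l + M.ζ n * M.β n)) + l * M.B

lemma dualValue_eq (l : ℝ) :
    M.dualValue l = ∑ n, M.a n * (max (M.ζ n * M.β n - l) 0 * M.load n 1) + l * M.B := by
  rw [dualValue, Finset.sum_filter]
  congr 1
  refine Finset.sum_congr rfl fun n _ => ?_
  split_ifs with h
  · rw [max_eq_left (by linarith), load]
    simp only [one_mul]
    ring
  · rw [max_eq_right (by linarith)]
    ring

lemma lagrangian_le_dualValue (l L : ℝ) (h : M.IsLagrangian ν π l L) : L ≤ M.dualValue l := by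
  obtain ⟨v, hv, rfl⟩ := h
  rw [dualValue_eq]
  gcongr
  -- The optimal value of one packet with `j` slots left: the net reward per transmission, truncated
  -- at `0`, times the expected number of transmissions when always sending.
  set W : Fin M.N → ℕ → ℝ := fun n j =>
    max (M.ζ n * M.β n - l) 0 * ((1 - (1 - M.ζ n) ^ j) / M.ζ n) with hW
  have hlim := M.tendsto_cesaro_potential ν π W (by simp [hW])
  have hC : ∑ n, M.a n * (max (M.ζ n * M.β n - l) 0 * M.load n 1)
      = ∑ n, M.a n * W n (M.τ n + M.D n) := by simp [hW, load]
  rw [hC]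
  refine le_of_tendsto_of_tendsto' hv hlim fun T => ?_
  gcongr
  rw [Finset.sum_comm, Finset.mul_sum, ← Finset.sum_sub_distrib]
  refine Finset.sum_le_sum fun t _ => ?_
  rw [Finset.mul_sum, ← Finset.sum_sub_distrib]
  have hn : ∀ n, M.β n * M.expDelivered ν π n t - l * M.expResource ν π n t
      = (M.ζ n * M.β n - l) * M.expResource ν π n t := fun n => by
    rw [expDelivered_eq]; ring
  simp only [hn]
  simp only [expResource_eq]
  rw [M.sum_user_eq (fun n => M.ζ n * M.β n - l)]
  refine Finset.sum_le_sum fun ξ _ => ?_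
  have hζ := M.ζ_pos ξ.1
  have hp := M.meanSend_le_meanAlive ν π t ξ
  have hq := M.meanSend_nonneg ν π t ξ
  set c := max (M.ζ ξ.1 * M.β ξ.1 - l) 0 with hc
  have hc0 : 0 ≤ c := le_max_right _ _
  have hx : 0 ≤ (1 - M.ζ ξ.1) ^ (ξ.2.1 : ℕ) := pow_nonneg (by linarith [M.ζ_le_one ξ.1]) _
  have h1 : W ξ.1 (ξ.2.1 + 1) - W ξ.1 ξ.2.1 = c * (1 - M.ζ ξ.1) ^ (ξ.2.1 : ℕ) := by
    simp only [hW, ← hc, pow_succ]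
    field_simp
    ring
  have h2 : M.ζ ξ.1 * W ξ.1 ξ.2.1 = c * (1 - (1 - M.ζ ξ.1) ^ (ξ.2.1 : ℕ)) := by
    simp only [hW, ← hc]
    field_simp
  rw [h1, h2]
  calc (M.ζ ξ.1 * M.β ξ.1 - l) * M.meanSend ν π t ξ ≤ c * M.meanSend ν π t ξ := by
        gcongr; exact le_max_left _ _
    -- The part weighted by the increment of `W` is enlarged from `meanSend` to `meanAlive`; the
    -- other part already matches.
    _ = c * (1 - M.ζ ξ.1) ^ (ξ.2.1 : ℕ) * M.meanSend ν π t ξ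
        + c * (1 - (1 - M.ζ ξ.1) ^ (ξ.2.1 : ℕ)) * M.meanSend ν π t ξ := by ring
    _ ≤ _ := by gcongr

lemma tendsto_expResource (θ : Fin M.N → ℝ)
    (hθ : ∀ s ξ, M.sendProb π s ξ = θ ξ.1 * M.alive s ξ) (n : Fin M.N) :
    Tendsto (fun T : ℕ => (1 / (T : ℝ)) * ∑ t ∈ Finset.Icc 1 T, M.expResource ν π n t)
      atTop (𝓝 (M.a n * M.load n (θ n))) := by
  -- Expected remaining transmissions of a packet of user `n`. Since `meanSend` is now proportional
  -- to `meanAlive`, the drift terms add up exactly to the expenditure.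
  set W : Fin M.N → ℕ → ℝ := fun m j =>
    if m = n then (1 - (1 - θ m * M.ζ m) ^ j) / M.ζ m else 0 with hW
  have hlim := M.tendsto_cesaro_potential ν π W (by simp [hW])
  have hC : ∑ m, M.a m * W m (M.τ m + M.D m) = M.a n * M.load n (θ n) := by
    simp [hW, load]
  rw [hC] at hlim
  refine hlim.congr fun T => ?_
  congr 1
  refine Finset.sum_congr rfl fun t _ => ?_
  rw [expResource_eq, Finset.sum_filter]
  refine Finset.sum_congr rfl fun ξ _ => ?_
  have hq : M.meanSend ν π t ξ = θ ξ.1 * M.meanAlive ν π t ξ := by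
    rw [meanSend, meanAlive, ← expect_const_mul]
    simp only [hθ]
  have hζ := M.ζ_pos ξ.1
  simp only [hW]
  split_ifs with h
  · rw [hq, pow_succ]
    field_simp
    ring
  · simp

lemma isThroughput_of_sendProb (θ : Fin M.N → ℝ)
    (hθ : ∀ s ξ, M.sendProb π s ξ = θ ξ.1 * M.alive s ξ) :
    M.IsThroughput ν π fun n => M.ζ n * (M.a n * M.load n (θ n)) := by
  intro n
  refine ((M.tendsto_expResource ν π θ hθ n).const_mul (M.ζ n)).congr fun T => ?_
  simp only [expDelivered_eq, ← Finset.mul_sum]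
  ring

lemma isExpenditure_of_sendProb (θ : Fin M.N → ℝ)
    (hθ : ∀ s ξ, M.sendProb π s ξ = θ ξ.1 * M.alive s ξ) :
    M.IsExpenditure ν π (∑ n, M.a n * M.load n (θ n)) := by
  refine (tendsto_finsetSum Finset.univ fun n _ =>
    M.tendsto_expResource ν π θ hθ n).congr fun T => ?_
  rw [← Finset.mul_sum, Finset.sum_comm]

variable {M ν π} in
lemma IsThroughput.isLagrangian {x : Fin M.N → ℝ} {e : ℝ} (hx : M.IsThroughput ν π x)
    (he : M.IsExpenditure ν π e) (l : ℝ) :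
    M.IsLagrangian ν π l (∑ n, M.β n * x n - l * e + l * M.B) := by
  refine ⟨_, ?_, rfl⟩
  have h₁ := tendsto_finsetSum Finset.univ fun n _ => (hx n).const_mul (M.β n)
  have h₂ := Tendsto.const_mul l (show Tendsto _ _ _ from he)
  refine (h₁.sub h₂).congr fun T => ?_
  rw [mul_sub]
  congr 1
  · rw [Finset.mul_sum]
    refine Finset.sum_congr rfl fun n _ => ?_
    rw [← Finset.mul_sum, mul_left_comm]
  · exact mul_left_comm _ _ _

/-! ### Threshold policies and complementary slackness -/

/-- The policy that transmits everything that is at the source for the users whose index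
`ζ n * β n` is greater than `l`, and, with probability `θ`, also for those whose index is `l`. -/
def thresholdPolicy (l θ : ℝ) (h₀ : 0 ≤ θ) (h₁ : θ ≤ 1) : M.Policy where
  decide s := (coinLaw θ h₀ h₁).map fun b => Finset.univ.filter fun ξ : M.Place =>
    s ξ = some false ∧ (l < M.ζ ξ.1 * M.β ξ.1 ∨ b = true ∧ l = M.ζ ξ.1 * M.β ξ.1)
  admissible s u hu ξ hξ := by
    obtain ⟨b, -, rfl⟩ := (PMF.mem_support_map_iff _ _ _).1 hu
    exact (Finset.mem_filter.1 hξ).2.1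

/-- The transmission probability of the packets of user `n` under the threshold policy. -/
def thresholdProb (l θ : ℝ) (n : Fin M.N) : ℝ :=
  if l < M.ζ n * M.β n then 1 else if l = M.ζ n * M.β n then θ else 0

lemma sendProb_thresholdPolicy (l θ : ℝ) (h₀ : 0 ≤ θ) (h₁ : θ ≤ 1) (s : M.State) (ξ : M.Place) :
    M.sendProb (M.thresholdPolicy l θ h₀ h₁) s ξ = M.thresholdProb l θ ξ.1 * M.alive s ξ := by
  simp only [sendProb, thresholdPolicy, expect_map, expect_coinLaw, thresholdProb, alive,
    Finset.mem_filter, Finset.mem_univ, true_and]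
  by_cases h1 : s ξ = some false <;> by_cases h2 : l < M.ζ ξ.1 * M.β ξ.1 <;>
    by_cases h3 : l = M.ζ ξ.1 * M.β ξ.1 <;> simp [h1, h2, h3]

lemma load_zero (n : Fin M.N) : M.load n 0 = 0 := by simp [load]

/-- The average expenditure of the threshold policy. -/
def thresholdExpenditure (l θ : ℝ) : ℝ := ∑ n, M.a n * M.load n (M.thresholdProb l θ n)

/-- Users with index exactly `l` have zero net reward, so `θ` changes the expenditure but not the
Lagrangian. -/
lemma threshold_lagrangian (l θ : ℝ) :
    ∑ n, M.β n * (M.ζ n * (M.a n * M.load n (M.thresholdProb l θ n)))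
      - l * M.thresholdExpenditure l θ + l * M.B = M.dualValue l := by
  rw [dualValue_eq, thresholdExpenditure, Finset.mul_sum, ← Finset.sum_sub_distrib]
  congr 1
  refine Finset.sum_congr rfl fun n _ => ?_
  unfold thresholdProb
  split_ifs with h1 h2
  · rw [max_eq_left (by linarith)]
    ring
  · rw [← h2, sub_self, max_self, h2]
    ring
  · rw [max_eq_right (by linarith), load_zero]
    ring

lemma continuous_thresholdExpenditure (l : ℝ) : Continuous (M.thresholdExpenditure l) := by
  unfold thresholdExpenditure load thresholdProb
  refine continuous_finsetSum _ fun n _ => ?_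
  split_ifs <;> fun_prop

lemma isGreatest_dualValue (l : ℝ) : IsGreatest (M.lagrangianValues ν l) (M.dualValue l) := by
  refine ⟨⟨M.thresholdPolicy l 0 le_rfl zero_le_one, ?_⟩, ?_⟩
  · rw [← M.threshold_lagrangian l 0]
    have hθ := M.sendProb_thresholdPolicy l 0 le_rfl zero_le_one
    exact (M.isThroughput_of_sendProb ν _ _ hθ).isLagrangian
      (M.isExpenditure_of_sendProb ν _ _ hθ) l
  · rintro L ⟨π, hπ⟩
    exact M.lagrangian_le_dualValue ν π l L hπ

/-- With no index strictly between `l'` and `l`, both sides serve exactly the users of index at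
least `l`. -/
lemma thresholdExpenditure_one_eq_of_next_smaller {l l' : ℝ} (hl : l' < l)
    (h : ∀ n, M.ζ n * M.β n < l → M.ζ n * M.β n ≤ l') :
    M.thresholdExpenditure l 1 = M.thresholdExpenditure l' 0 := by
  unfold thresholdExpenditure
  refine Finset.sum_congr rfl fun n _ => ?_
  congr 2
  unfold thresholdProb
  have := h n
  split_ifs <;> first | rfl | (exfalso; grind)

/-- The existence of an optimal multiplier with complementary slackness. -/
lemma exists_complementary_slackness :
    ∃ l θ : ℝ, 0 ≤ l ∧ 0 ≤ θ ∧ θ ≤ 1 ∧ M.thresholdExpenditure l θ ≤ M.B ∧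
      l * M.thresholdExpenditure l θ = l * M.B := by
  classical
  -- Candidate multipliers: expenditure can jump only at an index, and `0` covers the case of a
  -- slack budget.
  let S : Finset ℝ := insert 0 (Finset.univ.image fun n => M.ζ n * M.β n)
  have hS0 : ∀ l ∈ S, 0 ≤ l := by
    intro l hl
    rcases Finset.mem_insert.1 hl with rfl | hl
    · exact le_rfl
    · obtain ⟨n, -, rfl⟩ := Finset.mem_image.1 hl
      exact mul_nonneg (M.ζ_pos n).le (M.β_nonneg n)
  have hmemS : ∀ n, M.ζ n * M.β n ∈ S := fun n =>
    Finset.mem_insert_of_mem (Finset.mem_image_of_mem _ (Finset.mem_univ n))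
  have hne : S.Nonempty := ⟨0, Finset.mem_insert_self _ _⟩
  let F := S.filter fun l => M.thresholdExpenditure l 0 ≤ M.B
  have hF : F.Nonempty := by
    refine ⟨S.max' hne, Finset.mem_filter.2 ⟨S.max'_mem hne, ?_⟩⟩
    have : M.thresholdExpenditure (S.max' hne) 0 = 0 := by
      refine Finset.sum_eq_zero fun n _ => ?_
      rw [thresholdProb, if_neg (S.le_max' _ (hmemS n)).not_gt, ite_self, load_zero, mul_zero]
    rw [this]
    exact M.B_nonneg
  obtain ⟨hlS, hlB⟩ := Finset.mem_filter.1 (F.min'_mem hF)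
  set l := F.min' hF with hl
  rcases (hS0 l hlS).eq_or_lt with h0 | hpos
  · exact ⟨l, 0, h0.le, le_rfl, zero_le_one, hlB, by rw [← h0, zero_mul, zero_mul]⟩
  let G := S.filter fun l' => l' < l
  have hG : G.Nonempty := ⟨0, Finset.mem_filter.2 ⟨Finset.mem_insert_self _ _, hpos⟩⟩
  obtain ⟨hmS, hml⟩ := Finset.mem_filter.1 (G.max'_mem hG)
  -- By minimality of `l`, the preceding candidate overspends; randomizing at `l` interpolates
  -- between the two expenditures.
  have hlarge : M.B ≤ M.thresholdExpenditure l 1 := by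
    rw [M.thresholdExpenditure_one_eq_of_next_smaller hml fun n hn =>
      G.le_max' _ (Finset.mem_filter.2 ⟨hmemS n, hn⟩)]
    by_contra! hcon
    exact (F.min'_le _ (Finset.mem_filter.2 ⟨hmS, hcon.le⟩)).not_gt hml
  obtain ⟨θ, ⟨hθ0, hθ1⟩, hθ⟩ := intermediate_value_Icc zero_le_one
    (M.continuous_thresholdExpenditure l).continuousOn ⟨hlB, hlarge⟩
  exact ⟨l, θ, hpos.le, hθ0, hθ1, hθ.le, by rw [hθ]⟩

variable {M ν} in
lemma feasibleValue_le_dualValue {φ l : ℝ} (hφ : φ ∈ M.feasibleValues ν) (hl : 0 ≤ l) :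
    φ ≤ M.dualValue l := by
  obtain ⟨π, x, e, hx, he, heB, rfl⟩ := hφ
  have h := M.lagrangian_le_dualValue ν π l _ (hx.isLagrangian he l)
  have := mul_le_mul_of_nonneg_left heB hl
  linarith

end StaticSystem

end

theorem mainTheorem12 (M : StaticSystem) (ν : PMF M.State) :
    ∃ (g : ℝ → ℝ) (φ : ℝ),
      (∀ l : ℝ, IsGreatest (M.lagrangianValues ν l) (g l)) ∧
      (∀ l : ℝ, g l =
        (∑ n ∈ Finset.univ.filter (fun n : Fin M.N => l < M.ζ n * M.β n),
          M.a n * ((1 - (1 - M.ζ n) ^ (M.τ n + M.D n)) / M.ζ n) * (-l + M.ζ n * M.β n))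
        + l * M.B) ∧
      IsGreatest (M.feasibleValues ν) φ ∧
      IsLeast (g '' Set.Ici 0) φ := by
  obtain ⟨l, θ, hl, h₀, h₁, hB, hslack⟩ := M.exists_complementary_slackness
  have hθ := M.sendProb_thresholdPolicy l θ h₀ h₁
  -- Slackness cancels the multiplier terms, so the primal value of this policy is the dual value at
  -- `l`.
  have hmem : M.dualValue l ∈ M.feasibleValues ν :=
    ⟨_, _, _, M.isThroughput_of_sendProb ν _ _ hθ, M.isExpenditure_of_sendProb ν _ _ hθ, hB, by
      rw [← M.threshold_lagrangian l θ, hslack, sub_add_cancel]⟩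
  refine ⟨M.dualValue, M.dualValue l, M.isGreatest_dualValue ν, fun _ => rfl,
    ⟨hmem, fun φ hφ => StaticSystem.feasibleValue_le_dualValue hφ hl⟩, ⟨l, hl, rfl⟩, ?_⟩
  rintro _ ⟨l', hl', rfl⟩
  exact StaticSystem.feasibleValue_le_dualValue hmem hl'
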